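/- Let $\mathbb D=\{z\in\mathbb C:|z|<1\}$ and let $\mathcal H_0(\mathbb D)$ be the set of functions $f$ analytic in $\mathbb D$ with $f(0)=0$ and $f'(0)=1$. For $M>0$ let $$S_M=\left\{f\in\mathcal H_0(\mathbb D):\ f(z)\neq 0 \text{ and } \left|\frac{zf'(z)}{f(z)}-1\right|<M \text{ for all } z\in\mathbb D\setminus\{0\}\right\},$$ and let $K$ be the set of $f\in\mathcal H_0(\mathbb D)$ that are univalent in $\mathbb D$ and for which $f(\mathbb D)$ is a convex set. For an integer $c\ge 0$ and $f\in\mathcal H_0(\mathbb D)$ the Bernardi transform of $f$ is $$\mathcal B_c(f)(z)=\frac{1+c}{z^c}\int_0^z\zeta^{c-1}f(\zeta)\,d\zeta\quad(z\in\mathbb D\setminus\{0\}),\qquad \mathcal B_c(f)(0)=0 .$$ Let $c\in\{0,1,2,\dots\}$ and $M_c=\sqrt{c^2+1}-c$. If $0<M<M_c$ and $f\in S_M$, then $\mathcal B_c(f)$ is convex, that is, $\mathcal B_c(f)\in K$. Moreover $\mathcal B_c(S_{M_c})\subset K$. -/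

import Mathlib

namespace Bernardi

/-- The open unit disk of the complex plane. -/
def unitDisk : Set ℂ := Metric.ball (0 : ℂ) 1

/-- Functions analytic in the unit disk and normalized by `f 0 = 0`, `f' 0 = 1`. A function on the
disk is represented by a function on `ℂ` whose values outside the disk are irrelevant. -/
def classH0 : Set (ℂ → ℂ) :=
  {f | DifferentiableOn ℂ f unitDisk ∧ f 0 = 0 ∧ deriv f 0 = 1}

/-- Normalized univalent functions. -/
def classS : Set (ℂ → ℂ) := {f | f ∈ classH0 ∧ Set.InjOn f unitDisk}

/-- Normalized convex univalent functions: the image of the unit disk is a convex set. -/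
def classK : Set (ℂ → ℂ) := {f | f ∈ classS ∧ Convex ℝ (f '' unitDisk)}

/-- The class `S_M` of normalized `f` with `|z f'(z) / f(z) - 1| < M` on the disk. The quotient
has to make sense, so `f` has no zero except the origin; at the origin the quotient has a removable
singularity with value `1`, and the inequality there just says `0 < M`, which holds as soon as
the inequality holds at some other point. -/
def classSM (M : ℝ) : Set (ℂ → ℂ) :=
  {f | f ∈ classH0 ∧
    ∀ z ∈ unitDisk, z ≠ 0 → f z ≠ 0 ∧ ‖z * deriv f z / f z - 1‖ < M}

/-- The Bernardi transform `((1 + c) / z ^ c) ∫₀^z ζ ^ (c - 1) f(ζ) dζ`, the integral being taken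
along the segment `ζ = t z`, `0 ≤ t ≤ 1`. The exponent `c - 1` is an integer (it is `-1` for
`c = 0`). At `z = 0` the formula evaluates to `0`, the value of the analytic extension. -/
noncomputable def transform (c : ℕ) (f : ℂ → ℂ) (z : ℂ) : ℂ :=
  (1 + (c : ℂ)) / z ^ c *
    ∫ t in (0 : ℝ)..1, ((t : ℂ) * z) ^ ((c : ℤ) - 1) * f ((t : ℂ) * z) * z

end Bernardi

/-!
Since `S_M` grows with `M`, only `M = √(c² + 1) - c` matters, the positive root of
`M² + 2 c M = 1`; note that `M ≤ 1`. Write `f = z h` and `B_c(f) = F = z J`, where `J(z)` is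
`1 + c` times the integral of `t ^ c h(t z)` over `0 ≤ t ≤ 1`. The hypothesis says `|v| < M` for
`v = z h' / h`, and `F` solves `z F' + c F = (1 + c) f`. In terms of `u = z J' / J` this equation
becomes the Briot–Bouquet equation `v = u + z u' / (1 + c + u)`.

By Schwarz's lemma `log h` varies by at most `M ≤ 1 < π / 2` along a radius, so `Re (J / h) > 0`
(`re_transformQuot_div_pos`). Hence `J` has no zeros and `1 + c + u = (1 + c) h / J` has positive
real part. Jack's lemma (`exists_mul_deriv_mul_conj_nonneg`) then transfers the bound from `v` to
`u`: `|u| < M` (`norm_lt_of_briotBouquet`). Finally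
`1 + z F'' / F' = (1 + v) (1 + c / (1 + u)) - c`, and the two bounds make its real part positive
(`re_briotBouquet_pos`); this is where the equation for `M` is used.

It remains to see that `Re (1 + z F'' / F') > 0` forces `F` to be univalent with convex image
(`injOn_and_convex_image_of_re_pos`). The tangent of the curve `F(|z| = r)` turns monotonically and
once only, so each tangent line supports `F(|z| ≤ r)` (`re_sub_div_neg`). This gives
injectivity at once, and convexity because a point outside `F(|z| ≤ r)` is separated from it by
the tangent line at the nearest point, which Jack's lemma for `1 / (F - w)` locates.
-/

open Metric Set Filter Topology
open scoped ComplexConjugate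

namespace Bernardi

/-! ### Logarithms and Jack's lemma -/

/-- A zero-free holomorphic function on the disk has a holomorphic logarithm, a primitive of its
logarithmic derivative. -/
lemma exists_log_of_ne_zero {h : ℂ → ℂ} (hd : DifferentiableOn ℂ h unitDisk)
    (h0 : ∀ z ∈ unitDisk, h z ≠ 0) :
    ∃ H : ℂ → ℂ, (∀ z ∈ unitDisk, HasDerivAt H (deriv h z / h z) z) ∧
      ∀ z ∈ unitDisk, h z = Complex.exp (H z) := by
  have ho : IsOpen unitDisk := isOpen_ball
  have hmem : (0 : ℂ) ∈ unitDisk := by simp [unitDisk]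
  have hq : DifferentiableOn ℂ (fun z => deriv h z / h z) unitDisk :=
    (hd.deriv ho).div hd h0
  obtain ⟨H, hH0, hH⟩ := (DifferentiableOn.isExactOn_ball hq).with_val_at 0 (Complex.log (h 0))
  refine ⟨H, hH, fun z hz => ?_⟩
  -- `h * exp (-H)` has derivative zero on the disk, and its value at `0` is `1`.
  have hder : ∀ z ∈ unitDisk, HasDerivAt (fun z => h z * Complex.exp (-H z)) 0 z := by
    intro z hz
    have h1 := (hd.differentiableAt (ho.mem_nhds hz)).hasDerivAt.mul (hH z hz).neg.cexp
    convert! h1 using 1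
    have := h0 z hz
    field_simp
    ring
  have hconst : h z * Complex.exp (-H z) = h 0 * Complex.exp (-H 0) :=
    (convex_ball (0 : ℂ) 1).is_const_of_fderivWithin_eq_zero (𝕜 := ℂ)
      (fun x hx => (hder x hx).differentiableAt.differentiableWithinAt)
      (fun x hx => by
        rw [fderivWithin_of_isOpen isOpen_ball hx, (hder x hx).hasFDerivAt.fderiv]
        ext; simp) hz hmem
  rw [hH0, Complex.exp_neg (Complex.log _), Complex.exp_log (h0 0 hmem), mul_inv_cancel₀ (h0 0 hmem),
    Complex.exp_neg] at hconst
  exact (mul_inv_eq_one₀ (Complex.exp_ne_zero _)).1 hconst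

/-- **Jack's lemma.** Where `|u|` attains its maximum over `|z| ≤ r` on the boundary circle, the
tangential derivative of `|u|` vanishes and the radial one is nonnegative; together this says that
`z u'(z) / u(z)` is real and nonnegative (written without division). -/
lemma exists_mul_deriv_mul_conj_nonneg {u : ℂ → ℂ} {r : ℝ} (hr : 0 < r)
    (hu : ∀ z, ‖z‖ ≤ r → DifferentiableAt ℂ u z) :
    ∃ z₀ : ℂ, ‖z₀‖ = r ∧ (∀ z, ‖z‖ ≤ r → ‖u z‖ ≤ ‖u z₀‖) ∧
      ∃ k : ℝ, 0 ≤ k ∧ z₀ * deriv u z₀ * conj (u z₀) = k := by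
  have hcl : closure (ball (0 : ℂ) r) = closedBall 0 r := closure_ball _ hr.ne'
  obtain ⟨z₀, hz₀, hmax⟩ := Complex.exists_mem_frontier_isMaxOn_norm (f := u)
    (U := ball (0 : ℂ) r) isBounded_ball ⟨0, by simpa using hr⟩
    (DifferentiableOn.diffContOnCl (by
      rw [hcl]
      exact fun z hz => (hu z (by simpa using hz)).differentiableWithinAt))
  rw [frontier_ball _ hr.ne'] at hz₀
  have hz₀r : ‖z₀‖ = r := by simpa using hz₀
  rw [hcl] at hmax
  have hle : ∀ z, ‖z‖ ≤ r → ‖u z‖ ≤ ‖u z₀‖ := fun z hz => hmax (by simpa using hz)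
  refine ⟨z₀, hz₀r, hle, ?_⟩
  set W := z₀ * deriv u z₀ * conj (u z₀) with hW
  have hder : ∀ v : ℂ, HasDerivAt (fun t : ℝ => ‖u (z₀ * Complex.exp (t * v))‖ ^ 2)
      (2 * (v * W).re) 0 := by
    intro v
    have h1 : HasDerivAt (fun t : ℝ => z₀ * Complex.exp (t * v)) (z₀ * v) 0 := by
      have := ((((Complex.ofRealCLM.hasDerivAt (x := (0 : ℝ))).mul_const v).cexp).const_mul z₀)
      simpa using this
    have h2 : HasDerivAt (fun t : ℝ => u (z₀ * Complex.exp (t * v)))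
        (deriv u z₀ * (z₀ * v)) 0 := by
      have h3 : HasDerivAt u (deriv u z₀) (z₀ * Complex.exp ((0 : ℝ) * v)) := by
        simpa using (hu z₀ hz₀r.le).hasDerivAt
      exact h3.comp (0 : ℝ) h1
    convert! h2.norm_sq using 1
    simp only [Complex.ofReal_zero, zero_mul, Complex.exp_zero, mul_one, Complex.inner]
    rw [hW]
    congr 2
    ring
  have him : W.im = 0 := by
    have hloc : IsLocalMax (fun t : ℝ => ‖u (z₀ * Complex.exp (t * Complex.I))‖ ^ 2) 0 := by
      refine Eventually.of_forall fun t => ?_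
      simp only [Complex.ofReal_zero, zero_mul, Complex.exp_zero, mul_one]
      gcongr
      exact hle _ (by simp [Complex.norm_exp_ofReal_mul_I, hz₀r])
    have := hloc.hasDerivAt_eq_zero (hder Complex.I)
    simpa using this
  have hre : 0 ≤ W.re := by
    have h1 := ((hder 1).tendsto_slope).mono_left
      (nhdsLT_le_nhdsNE (0 : ℝ))
    have h2 : 0 ≤ 2 * (1 * W).re := by
      refine ge_of_tendsto h1 ?_
      filter_upwards [self_mem_nhdsWithin] with t ht
      have ht : t < 0 := ht
      rw [slope_def_field]
      refine div_nonneg_of_nonpos ?_ (by linarith)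
      simp only [Complex.ofReal_zero, Complex.exp_zero, mul_one, sub_nonpos]
      gcongr
      refine hle _ ?_
      rw [norm_mul, hz₀r, Complex.norm_exp, Complex.ofReal_re]
      exact mul_le_of_le_one_right hr.le (Real.exp_le_one_iff.2 ht.le)
    simpa using h2
  exact ⟨W.re, hre, Complex.ext (by simp) (by simp [him])⟩

/-! ### The analytic criterion for convexity -/

/-- As `z` runs once round the circle through `z₀`, the argument of the tangent increases by `2π`, so
the component of `F z - F z₀` along the outer normal `z₀ F'(z₀)` first decreases, then increases
back to `0`. -/
lemma re_sub_div_neg_of_norm_eq {F H : ℂ → ℂ}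
    (hF : ∀ z ∈ unitDisk, HasDerivAt F (Complex.exp (H z)) z)
    (hH : ∀ z ∈ unitDisk, DifferentiableAt ℂ H z)
    (hpos : ∀ z ∈ unitDisk, 0 < (1 + z * deriv H z).re)
    {z₀ z : ℂ} (hz₀ : z₀ ∈ unitDisk) (h0 : z₀ ≠ 0) (hz : ‖z‖ = ‖z₀‖) (hne : z ≠ z₀) :
    ((F z - F z₀) / (z₀ * Complex.exp (H z₀))).re < 0 := by
  set e : ℝ → ℂ := fun θ => z₀ * Complex.exp (θ * Complex.I) with he
  have hemem : ∀ θ, e θ ∈ unitDisk := by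
    intro θ
    simpa [he, unitDisk, Complex.norm_exp_ofReal_mul_I] using hz₀
  have hed : ∀ θ, HasDerivAt e (e θ * Complex.I) θ := by
    intro θ
    have := ((((Complex.ofRealCLM.hasDerivAt (x := θ)).mul_const Complex.I).cexp).const_mul z₀)
    simpa [he, mul_assoc] using this
  set β : ℝ → ℂ := fun θ => θ * Complex.I + H (e θ) - H z₀ with hβ
  have hβd : ∀ θ, HasDerivAt β (Complex.I * (1 + e θ * deriv H (e θ))) θ := by
    intro θ
    have h1 : HasDerivAt (fun θ : ℝ => (θ : ℂ) * Complex.I) Complex.I θ := by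
      simpa using (Complex.ofRealCLM.hasDerivAt (x := θ)).mul_const Complex.I
    have h2 := (hH _ (hemem θ)).hasDerivAt.comp θ (hed θ)
    convert! (h1.add h2).sub_const (H z₀) using 1
    ring
  have hbd : ∀ θ, HasDerivAt (fun θ => (β θ).im) (1 + e θ * deriv H (e θ)).re θ := by
    intro θ
    have := Complex.imCLM.hasFDerivAt.comp_hasDerivAt θ (hβd θ)
    convert! this using 1
    simp
  have hmono : StrictMono (fun θ => (β θ).im) :=
    strictMono_of_hasDerivAt_pos hbd fun θ => hpos _ (hemem θ)
  have hb0 : (β 0).im = 0 := by simp [hβ, he]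
  have hb2 : (β (2 * Real.pi)).im = 2 * Real.pi := by simp [hβ, he]
  have hπ := Real.pi_pos
  set s : ℝ → ℝ := fun θ => ((F (e θ) - F z₀) / (z₀ * Complex.exp (H z₀))).re with hs
  have hsd : ∀ θ, HasDerivAt s (-(Real.exp (β θ).re * Real.sin (β θ).im)) θ := by
    intro θ
    have h1 := (((hF _ (hemem θ)).comp θ (hed θ)).sub_const (F z₀)).div_const
      (z₀ * Complex.exp (H z₀))
    have h2 := Complex.reCLM.hasFDerivAt.comp_hasDerivAt θ h1
    convert! h2 using 1
    have h3 : Complex.exp (H (e θ)) * (e θ * Complex.I) / (z₀ * Complex.exp (H z₀))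
        = Complex.I * Complex.exp (β θ) := by
      simp only [hβ, Complex.exp_sub, Complex.exp_add]
      have := Complex.exp_ne_zero (H z₀)
      simp only [he]
      field_simp
    rw [h3]
    simp [Complex.exp_im]
  have hsc : Continuous s := continuous_iff_continuousAt.2 fun θ => (hsd θ).continuousAt
  obtain ⟨θ₁, ⟨hθ₁0, hθ₁2⟩, hθ₁⟩ : ∃ θ ∈ Icc 0 (2 * Real.pi), (β θ).im = Real.pi := by
    have hc : ContinuousOn (fun θ => (β θ).im) (Icc 0 (2 * Real.pi)) :=
      (continuous_iff_continuousAt.2 fun θ => (hbd θ).continuousAt).continuousOn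
    exact intermediate_value_Icc (by positivity) hc ⟨by rw [hb0]; exact hπ.le, by rw [hb2]; linarith⟩
  have hanti : StrictAntiOn s (Icc 0 θ₁) := by
    refine strictAntiOn_of_deriv_neg (convex_Icc _ _) hsc.continuousOn fun θ hθ => ?_
    rw [interior_Icc] at hθ
    rw [(hsd θ).deriv, neg_lt_zero]
    refine mul_pos (Real.exp_pos _) (Real.sin_pos_of_pos_of_lt_pi ?_ ?_)
    · rw [← hb0]; exact hmono hθ.1
    · rw [← hθ₁]; exact hmono hθ.2
  have hmon : StrictMonoOn s (Icc θ₁ (2 * Real.pi)) := by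
    refine strictMonoOn_of_deriv_pos (convex_Icc _ _) hsc.continuousOn fun θ hθ => ?_
    rw [interior_Icc] at hθ
    rw [(hsd θ).deriv, neg_pos]
    refine mul_neg_of_pos_of_neg (Real.exp_pos _) ?_
    have h1 : Real.pi < (β θ).im := by rw [← hθ₁]; exact hmono hθ.1
    have h2 : (β θ).im < 2 * Real.pi := by rw [← hb2]; exact hmono hθ.2
    rw [← Real.sin_sub_two_pi]
    exact Real.sin_neg_of_neg_of_neg_pi_lt (by linarith) (by linarith)
  have hs0 : s 0 = 0 := by simp [hs, he]
  have hs2 : s (2 * Real.pi) = 0 := by simp [hs, he]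
  obtain ⟨θ, hθ0, hθ2, rfl⟩ : ∃ θ, 0 < θ ∧ θ < 2 * Real.pi ∧ e θ = z := by
    have hw : ‖z / z₀‖ = 1 := by rw [norm_div, hz, div_self (norm_ne_zero_iff.2 h0)]
    have hez : e (Complex.arg (z / z₀)) = z := by
      have h1 := Complex.norm_mul_exp_arg_mul_I (z / z₀)
      rw [hw, Complex.ofReal_one, one_mul] at h1
      simp only [he, h1]
      field_simp
    have hl := Complex.neg_pi_lt_arg (z / z₀)
    have hu := Complex.arg_le_pi (z / z₀)
    rcases lt_trichotomy 0 (Complex.arg (z / z₀)) with h | h | h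
    · exact ⟨_, h, by linarith, hez⟩
    · rw [← h] at hez
      exact absurd hez.symm (by simpa [he] using hne)
    · refine ⟨Complex.arg (z / z₀) + 2 * Real.pi, by linarith, by linarith, ?_⟩
      refine Eq.trans ?_ hez
      simp [he, add_mul, Complex.exp_add]
  change s θ < 0
  rcases le_total θ θ₁ with h | h
  · rw [← hs0]; exact hanti ⟨le_rfl, hθ₁0⟩ ⟨hθ0.le, h⟩ hθ0
  · rw [← hs2]; exact hmon ⟨h, hθ2.le⟩ ⟨hθ₁2, le_rfl⟩ hθ2

/-- The line through `F z₀` orthogonal to `z₀ F'(z₀)` supports the image of `|z| ≤ |z₀|`. Inside the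
circle this is the maximum principle for the harmonic function on the left. -/
lemma re_sub_div_neg {F H : ℂ → ℂ}
    (hF : ∀ z ∈ unitDisk, HasDerivAt F (Complex.exp (H z)) z)
    (hH : ∀ z ∈ unitDisk, DifferentiableAt ℂ H z)
    (hpos : ∀ z ∈ unitDisk, 0 < (1 + z * deriv H z).re)
    {z₀ z : ℂ} (hz₀ : z₀ ∈ unitDisk) (hz : ‖z‖ ≤ ‖z₀‖) (hne : z ≠ z₀) :
    ((F z - F z₀) / (z₀ * Complex.exp (H z₀))).re < 0 := by
  have h0 : z₀ ≠ 0 := by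
    rintro rfl
    exact hne (by simpa using hz)
  have hr : 0 < ‖z₀‖ := norm_pos_iff.2 h0
  have hr1 : ‖z₀‖ < 1 := by simpa [unitDisk] using hz₀
  have hmem : ∀ w : ℂ, ‖w‖ ≤ ‖z₀‖ → w ∈ unitDisk := fun w hw => by
    simpa [unitDisk] using hw.trans_lt hr1
  set κ : ℂ := (z₀ * Complex.exp (H z₀))⁻¹ with hκ
  have hκ0 : κ ≠ 0 := inv_ne_zero (mul_ne_zero h0 (Complex.exp_ne_zero _))
  set G : ℂ → ℂ := fun w => (F w - F z₀) * κ with hG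
  have hGd : ∀ w ∈ unitDisk, HasDerivAt G (Complex.exp (H w) * κ) w := fun w hw =>
    ((hF w hw).sub_const _).mul_const _
  rcases hz.lt_or_eq with hlt | heq
  swap
  · exact re_sub_div_neg_of_norm_eq hF hH hpos hz₀ h0 heq hne
  have hcl : closure (ball (0 : ℂ) ‖z₀‖) = closedBall 0 ‖z₀‖ := closure_ball _ hr.ne'
  have hle : ∀ w : ℂ, ‖w‖ ≤ ‖z₀‖ → (G w).re ≤ 0 := by
    intro w hw
    have := Complex.norm_le_of_forall_mem_frontier_norm_le (f := fun w => Complex.exp (G w))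
      (U := ball (0 : ℂ) ‖z₀‖) isBounded_ball (C := 1) (z := w)
      (DifferentiableOn.diffContOnCl (by
        rw [hcl]
        exact fun z hz =>
          ((hGd z (hmem z (by simpa using hz))).differentiableAt.cexp).differentiableWithinAt))
      (by
        intro x hx
        rw [frontier_ball _ hr.ne'] at hx
        have hx : ‖x‖ = ‖z₀‖ := by simpa using hx
        rw [Complex.norm_exp, Real.exp_le_one_iff]
        rcases eq_or_ne x z₀ with rfl | hxne
        · simp [hG]
        · exact (re_sub_div_neg_of_norm_eq hF hH hpos hz₀ h0 hx hxne).le)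
      (by rw [hcl]; simpa using hw)
    rwa [Complex.norm_exp, Real.exp_le_one_iff] at this
  refine lt_of_le_of_ne (hle z hz) fun h => ?_
  -- A zero inside the circle would be an interior maximum of `Re G`, but `G' ≠ 0`.
  set a := Complex.exp (H z) * κ with ha
  have ha0 : a ≠ 0 := mul_ne_zero (Complex.exp_ne_zero _) hκ0
  have hline : HasDerivAt (fun t : ℝ => z + t * conj a) (conj a) 0 := by
    simpa using ((Complex.ofRealCLM.hasDerivAt (x := (0 : ℝ))).mul_const (conj a)).const_add z
  have hd : HasDerivAt (fun t : ℝ => (G (z + t * conj a)).re) (a * conj a).re 0 := by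
    have h1 : HasDerivAt G a (z + (0 : ℝ) * conj a) := by simpa using hGd z (hmem z hz)
    exact Complex.reCLM.hasFDerivAt.comp_hasDerivAt (0 : ℝ) (h1.comp (0 : ℝ) hline)
  have hmax : IsLocalMax (fun t : ℝ => (G (z + t * conj a)).re) 0 := by
    have hev : ∀ᶠ t : ℝ in 𝓝 0, ‖z + t * conj a‖ < ‖z₀‖ :=
      hline.continuousAt.norm.eventually_lt_const (by simpa using hlt)
    filter_upwards [hev] with t ht
    have h0' : (G (z + (0 : ℝ) * conj a)).re = 0 := by
      simpa [hG, hκ, div_eq_mul_inv] using h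
    rw [h0']
    exact hle _ ht.le
  have := hmax.hasDerivAt_eq_zero hd
  rw [Complex.mul_conj, Complex.ofReal_re, Complex.normSq_eq_zero] at this
  exact ha0 this

/-- **Analytic criterion for convexity.** If `F'` has no zero and `Re (1 + z F'' / F') > 0` on the
disk, then `F` is univalent and maps the disk onto a convex set. -/
theorem injOn_and_convex_image_of_re_pos {F G : ℂ → ℂ}
    (hF : ∀ z ∈ unitDisk, HasDerivAt F (G z) z) (hG : DifferentiableOn ℂ G unitDisk)
    (hG0 : ∀ z ∈ unitDisk, G z ≠ 0)
    (hpos : ∀ z ∈ unitDisk, 0 < (1 + z * (deriv G z / G z)).re) :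
    InjOn F unitDisk ∧ Convex ℝ (F '' unitDisk) := by
  obtain ⟨H, hH, hGH⟩ := exists_log_of_ne_zero hG hG0
  have hkey : ∀ z₀ ∈ unitDisk, ∀ z, ‖z‖ ≤ ‖z₀‖ → z ≠ z₀ →
      ((F z - F z₀) / (z₀ * G z₀)).re < 0 := by
    intro z₀ hz₀ z hz hne
    rw [hGH z₀ hz₀]
    exact re_sub_div_neg (fun z hz => hGH z hz ▸ hF z hz) (fun z hz => (hH z hz).differentiableAt)
      (fun z hz => by rw [(hH z hz).deriv]; exact hpos z hz) hz₀ hz hne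
  constructor
  · intro a ha b hb hab
    by_contra hne
    rcases le_total ‖a‖ ‖b‖ with h | h
    · simpa [hab] using hkey b hb a h hne
    · simpa [hab] using hkey a ha b h (Ne.symm hne)
  · rw [convex_iff_forall_pos]
    rintro _ ⟨a, ha, rfl⟩ _ ⟨b, hb, rfl⟩ s t hs ht hst
    have ha1 : ‖a‖ < 1 := by simpa [unitDisk] using ha
    have hb1 : ‖b‖ < 1 := by simpa [unitDisk] using hb
    obtain ⟨r, hr, hr1⟩ := exists_between (max_lt ha1 hb1)
    have har : ‖a‖ < r := (le_max_left _ _).trans_lt hr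
    have hbr : ‖b‖ < r := (le_max_right _ _).trans_lt hr
    have hr0 : 0 < r := (norm_nonneg a).trans_lt har
    by_contra hw
    set w := s • F a + t • F b with hwdef
    have hmem : ∀ z : ℂ, ‖z‖ ≤ r → z ∈ unitDisk := fun z hz => by
      simpa [unitDisk] using hz.trans_lt hr1
    have hwF : ∀ z : ℂ, ‖z‖ ≤ r → F z - w ≠ 0 := fun z hz h =>
      hw ⟨z, hmem z hz, sub_eq_zero.1 h⟩
    -- At the point `F z₀` of the curve `F(|z| = r)` closest to `w`, the vector `w - F z₀` is an
    -- outer normal, so `w` lies beyond the supporting line there, unlike `F a` and `F b`.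
    obtain ⟨z₀, hz₀, -, k, hk, hk'⟩ := exists_mul_deriv_mul_conj_nonneg (u := fun z => (F z - w)⁻¹)
      hr0 (fun z hz => ((hF z (hmem z hz)).differentiableAt.sub_const w).inv (hwF z hz))
    have hz₀m := hmem z₀ hz₀.le
    have hne0 := hwF z₀ hz₀.le
    have hder : deriv (fun z => (F z - w)⁻¹) z₀ = -G z₀ / (F z₀ - w) ^ 2 :=
      (((hF z₀ hz₀m).sub_const w).inv hne0).deriv
    rw [hder] at hk'
    have hz₀0 : z₀ ≠ 0 := norm_ne_zero_iff.1 (hz₀ ▸ hr0.ne')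
    have hn0 : z₀ * G z₀ ≠ 0 := mul_ne_zero hz₀0 (hG0 z₀ hz₀m)
    have hA := hkey z₀ hz₀m a (by linarith) (by rintro rfl; linarith)
    have hB := hkey z₀ hz₀m b (by linarith) (by rintro rfl; linarith)
    have hW : ((w - F z₀) / (z₀ * G z₀)).re < 0 := by
      have : (w - F z₀) / (z₀ * G z₀) = (s : ℂ) * ((F a - F z₀) / (z₀ * G z₀)) +
          (t : ℂ) * ((F b - F z₀) / (z₀ * G z₀)) := by
        have hst' : (s : ℂ) + t = 1 := by exact_mod_cast hst
        rw [← mul_div_assoc, ← mul_div_assoc, ← add_div]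
        congr 1
        simp only [hwdef, Complex.real_smul]
        linear_combination (-F z₀) * hst'.symm
      rw [this, Complex.add_re, Complex.re_ofReal_mul, Complex.re_ofReal_mul]
      nlinarith
    have hrel : z₀ * G z₀ = (k * Complex.normSq (F z₀ - w) : ℝ) * (w - F z₀) := by
      have hc0 : conj (F z₀ - w) ≠ 0 := (map_ne_zero _).2 hne0
      rw [map_inv₀] at hk'
      rw [Complex.ofReal_mul, ← Complex.mul_conj, ← hk']
      field_simp
      ring
    have hinv : (w - F z₀) / (z₀ * G z₀) = ((k * Complex.normSq (F z₀ - w))⁻¹ : ℝ) := by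
      have hw0 : w - F z₀ ≠ 0 := by rw [← neg_sub]; exact neg_ne_zero.2 hne0
      rw [hrel] at hn0 ⊢
      have := left_ne_zero_of_mul hn0
      rw [Complex.ofReal_inv]
      field_simp
    rw [hinv, Complex.ofReal_re] at hW
    have : 0 ≤ (k * Complex.normSq (F z₀ - w))⁻¹ :=
      inv_nonneg.2 (mul_nonneg hk (Complex.normSq_nonneg _))
    linarith

/-! ### The differential equation of the Bernardi transform -/

/-- The factor `B_c(f)(z) / z` of the Bernardi transform, in terms of `h(z) = f(z) / z`. -/
noncomputable def transformQuot (c : ℕ) (h : ℂ → ℂ) (z : ℂ) : ℂ :=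
  (1 + (c : ℂ)) * ∫ t in (0 : ℝ)..1, (t : ℂ) ^ c * h (t * z)

lemma ofReal_mul_mem_unitDisk {t : ℝ} (h0 : 0 ≤ t) (h1 : t ≤ 1) {z : ℂ} (hz : z ∈ unitDisk) :
    (t : ℂ) * z ∈ unitDisk := by
  have hz : ‖z‖ < 1 := by simpa [unitDisk] using hz
  have : ‖(t : ℂ) * z‖ ≤ ‖z‖ := by
    rw [norm_mul, Complex.norm_real, Real.norm_of_nonneg h0]
    exact mul_le_of_le_one_left (norm_nonneg _) h1
  simpa [unitDisk] using this.trans_lt hz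

lemma deriv_id_mul {g : ℂ → ℂ} {z : ℂ} (hg : DifferentiableAt ℂ g z) :
    deriv (fun w => w * g w) z = g z + z * deriv g z := by
  have h := ((hasDerivAt_id' z).mul hg.hasDerivAt).deriv
  rw [one_mul] at h
  exact h

lemma transform_eq_mul {c : ℕ} {f h : ℂ → ℂ} (hfh : ∀ z ∈ unitDisk, f z = z * h z) {z : ℂ}
    (hz : z ∈ unitDisk) : transform c f z = z * transformQuot c h z := by
  rcases eq_or_ne z 0 with rfl | hz0
  · simp [transform]
  have hint : ∫ t in (0 : ℝ)..1, ((t : ℂ) * z) ^ ((c : ℤ) - 1) * f ((t : ℂ) * z) * z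
      = ∫ t in (0 : ℝ)..1, (z ^ c * z) * ((t : ℂ) ^ c * h (t * z)) := by
    refine intervalIntegral.integral_congr_uIoo fun t ht => ?_
    rw [uIoo_of_le zero_le_one] at ht
    have ht0 : (t : ℂ) ≠ 0 := by exact_mod_cast ht.1.ne'
    rw [hfh _ (ofReal_mul_mem_unitDisk ht.1.le ht.2.le hz), zpow_sub_one₀ (mul_ne_zero ht0 hz0),
      zpow_natCast]
    field_simp
    ring
  rw [transform, transformQuot, hint, intervalIntegral.integral_const_mul]
  field_simp

lemma continuousOn_pow_mul_comp_mul (n : ℕ) {g : ℂ → ℂ} (hg : ContinuousOn g unitDisk) {z : ℂ}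
    (hz : z ∈ unitDisk) : ContinuousOn (fun t : ℝ => (t : ℂ) ^ n * g (t * z)) (uIcc 0 1) := by
  rw [uIcc_of_le zero_le_one]
  refine ContinuousOn.mul (by fun_prop) (hg.comp (by fun_prop) ?_)
  exact fun t ht => ofReal_mul_mem_unitDisk ht.1 ht.2 hz

lemma hasDerivAt_transformQuot (c : ℕ) {h : ℂ → ℂ} (hd : DifferentiableOn ℂ h unitDisk) {z : ℂ}
    (hz : z ∈ unitDisk) :
    HasDerivAt (transformQuot c h)
      ((1 + (c : ℂ)) * ∫ t in (0 : ℝ)..1, (t : ℂ) ^ (c + 1) * deriv h (t * z)) z := by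
  have ho : IsOpen unitDisk := isOpen_ball
  have hd' : ContinuousOn (deriv h) unitDisk := (hd.deriv ho).continuousOn
  have hz1 : ‖z‖ < 1 := by simpa [unitDisk] using hz
  obtain ⟨ρ, hzρ, hρ1⟩ := exists_between hz1
  have hsub : closedBall (0 : ℂ) ρ ⊆ unitDisk := closedBall_subset_ball hρ1
  obtain ⟨C, hC⟩ := (isCompact_closedBall (0 : ℂ) ρ).exists_bound_of_continuousOn (hd'.mono hsub)
  have hs : ball (0 : ℂ) ρ ∈ 𝓝 z := isOpen_ball.mem_nhds (by simpa using hzρ)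
  have hint : ∀ n : ℕ, ∀ {g : ℂ → ℂ}, ContinuousOn g unitDisk → ∀ w ∈ unitDisk,
      IntervalIntegrable (fun t : ℝ => (t : ℂ) ^ n * g (t * w)) MeasureTheory.volume 0 1 :=
    fun n g hg w hw => (continuousOn_pow_mul_comp_mul n hg hw).intervalIntegrable
  refine HasDerivAt.const_mul _ (intervalIntegral.hasDerivAt_integral_of_dominated_loc_of_deriv_le
    (F := fun w t => (t : ℂ) ^ c * h (t * w))
    (F' := fun w t => (t : ℂ) ^ (c + 1) * deriv h (t * w)) (bound := fun _ => C) hs ?_ ?_ ?_ ?_ ?_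
    ?_).2
  · filter_upwards [ho.mem_nhds hz] with w hw
    exact (hint c hd.continuousOn w hw).def'.aestronglyMeasurable
  · exact hint c hd.continuousOn z hz
  · exact (hint (c + 1) hd' z hz).def'.aestronglyMeasurable
  · refine Eventually.of_forall fun t ht w hw => ?_
    rw [uIoc_of_le zero_le_one] at ht
    have hw : ‖w‖ < ρ := by simpa using hw
    have h1 : ‖(t : ℂ) * w‖ ≤ ρ := by
      rw [norm_mul, Complex.norm_real, Real.norm_of_nonneg ht.1.le]
      exact (mul_le_of_le_one_left (norm_nonneg _) ht.2).trans hw.le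
    rw [norm_mul, norm_pow, Complex.norm_real, Real.norm_of_nonneg ht.1.le]
    exact (mul_le_of_le_one_left (norm_nonneg _) (pow_le_one₀ ht.1.le ht.2)).trans
      (hC _ (by simpa using h1))
  · exact intervalIntegrable_const
  · refine Eventually.of_forall fun t ht w hw => ?_
    rw [uIoc_of_le zero_le_one] at ht
    have hmem : (t : ℂ) * w ∈ unitDisk :=
      ofReal_mul_mem_unitDisk ht.1.le ht.2 (hsub (ball_subset_closedBall hw))
    have h1 : HasDerivAt (fun w : ℂ => (t : ℂ) * w) (t : ℂ) w := by
      simpa using (hasDerivAt_id w).const_mul (t : ℂ)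
    have h2 := ((hd.differentiableAt (ho.mem_nhds hmem)).hasDerivAt.comp w h1).const_mul
      ((t : ℂ) ^ c)
    convert! h2 using 1
    ring

lemma differentiableOn_transformQuot (c : ℕ) {h : ℂ → ℂ} (hd : DifferentiableOn ℂ h unitDisk) :
    DifferentiableOn ℂ (transformQuot c h) unitDisk := fun _ hz =>
  (hasDerivAt_transformQuot c hd hz).differentiableAt.differentiableWithinAt

/-- The differential equation `z F' + c F = (1 + c) f` of the Bernardi transform, divided by `z`. -/
lemma mul_deriv_transformQuot_add (c : ℕ) {h : ℂ → ℂ} (hd : DifferentiableOn ℂ h unitDisk) {z : ℂ}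
    (hz : z ∈ unitDisk) :
    z * deriv (transformQuot c h) z + (1 + c) * transformQuot c h z = (1 + c) * h z := by
  have ho : IsOpen unitDisk := isOpen_ball
  have hd' : ContinuousOn (deriv h) unitDisk := (hd.deriv ho).continuousOn
  have hi1 := (continuousOn_pow_mul_comp_mul c hd.continuousOn hz).intervalIntegrable
    (μ := MeasureTheory.volume)
  have hi2 := (continuousOn_pow_mul_comp_mul (c + 1) hd' hz).intervalIntegrable
    (μ := MeasureTheory.volume)
  have hder : ∀ t ∈ uIcc (0 : ℝ) 1, HasDerivAt (fun t : ℝ => (t : ℂ) ^ (c + 1) * h (t * z))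
      ((1 + (c : ℂ)) * ((t : ℂ) ^ c * h (t * z)) + z * ((t : ℂ) ^ (c + 1) * deriv h (t * z))) t := by
    intro t ht
    rw [uIcc_of_le zero_le_one] at ht
    have h1 : HasDerivAt (fun t : ℝ => (t : ℂ) * z) z t := by
      simpa using (Complex.ofRealCLM.hasDerivAt (x := t)).mul_const z
    have h2 := (hd.differentiableAt
      (ho.mem_nhds (ofReal_mul_mem_unitDisk ht.1 ht.2 hz))).hasDerivAt.comp t h1
    have h3 : HasDerivAt (fun t : ℝ => (t : ℂ) ^ (c + 1)) ((c + 1 : ℕ) * (t : ℂ) ^ c) t := by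
      simpa using (hasDerivAt_pow (c + 1) (t : ℂ)).comp_ofReal
    convert! h3.mul h2 using 1
    push_cast
    simp only [Function.comp]
    ring
  have hftc := intervalIntegral.integral_eq_sub_of_hasDerivAt hder
    ((hi1.const_mul _).add (hi2.const_mul _))
  rw [intervalIntegral.integral_add (hi1.const_mul _) (hi2.const_mul _),
    intervalIntegral.integral_const_mul, intervalIntegral.integral_const_mul] at hftc
  simp only [Complex.ofReal_one, one_pow, one_mul, Complex.ofReal_zero, zero_mul, ne_eq,
    Nat.succ_ne_zero, not_false_eq_true, zero_pow, sub_zero] at hftc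
  rw [(hasDerivAt_transformQuot c hd hz).deriv, transformQuot]
  linear_combination (1 + (c : ℂ)) * hftc

lemma transformQuot_zero (c : ℕ) (h : ℂ → ℂ) : transformQuot c h 0 = h 0 := by
  have hc : (1 + (c : ℂ)) ≠ 0 := by exact_mod_cast (by omega : 1 + c ≠ 0)
  have h1 : ∫ t in (0 : ℝ)..1, (t : ℂ) ^ c = 1 / (1 + (c : ℂ)) := by
    have := integral_pow (a := 0) (b := 1) c
    have h2 : ∫ t in (0 : ℝ)..1, (t : ℂ) ^ c = ((∫ t in (0 : ℝ)..1, t ^ c : ℝ) : ℂ) := by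
      rw [← intervalIntegral.integral_ofReal]
      simp
    rw [h2, this]
    push_cast
    simp [add_comm]
  simp only [transformQuot, mul_zero, intervalIntegral.integral_mul_const, h1]
  field_simp

/-- If `|z h' / h| < M ≤ 1`, Schwarz's lemma gives `|h' / h| ≤ M`, so a branch of `log h` varies by
less than `π / 2` along a radius, and the average `transformQuot c h z` of the values of `h` on
`[0, z]` lies in the half-plane `Re (w / h z) > 0`. -/
lemma re_transformQuot_div_pos (c : ℕ) {h : ℂ → ℂ} {M : ℝ} (hM1 : M ≤ 1)
    (hd : DifferentiableOn ℂ h unitDisk) (h0 : ∀ z ∈ unitDisk, h z ≠ 0)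
    (hv : ∀ z ∈ unitDisk, ‖z * (deriv h z / h z)‖ < M) {z : ℂ} (hz : z ∈ unitDisk) :
    0 < (transformQuot c h z / h z).re := by
  have ho : IsOpen unitDisk := isOpen_ball
  obtain ⟨H, hH, hexp⟩ := exists_log_of_ne_zero hd h0
  have hq : DifferentiableOn ℂ (fun z => deriv h z / h z) unitDisk := (hd.deriv ho).div hd h0
  have hbound : ∀ w ∈ unitDisk, ‖deriv h w / h w‖ ≤ M := by
    intro w hw
    have hs := Complex.norm_dslope_le_div_of_mapsTo_ball
      (f := fun z => z * (deriv h z / h z)) (c := 0) (R₁ := 1) (R₂ := M) (differentiableOn_id.mul hq)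
      (fun x hx => by simpa using (hv x hx).le) hw
    rw [div_one] at hs
    rcases eq_or_ne w 0 with rfl | hw0
    · rw [dslope_same, deriv_id_mul (hq.differentiableAt (ho.mem_nhds hw))] at hs
      simpa using hs
    · rw [dslope_of_ne _ hw0, slope_def_field] at hs
      simpa [hw0] using hs
  have hz1 : ‖z‖ < 1 := by simpa [unitDisk] using hz
  set g : ℝ → ℂ := fun t => (t : ℂ) ^ c * h (t * z) / h z with hg
  have hgi : IntervalIntegrable g MeasureTheory.volume 0 1 :=
    ((continuousOn_pow_mul_comp_mul c hd.continuousOn hz).div_const _).intervalIntegrable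
  have heq : transformQuot c h z / h z = ((1 + c : ℝ) : ℂ) * ∫ t in (0 : ℝ)..1, g t := by
    rw [hg, intervalIntegral.integral_div, transformQuot]
    push_cast
    ring
  rw [heq, Complex.re_ofReal_mul]
  refine mul_pos (by positivity) ?_
  have hre := Complex.reCLM.intervalIntegral_comp_comm hgi
  simp only [Complex.reCLM_apply] at hre
  rw [← hre]
  refine intervalIntegral.intervalIntegral_pos_of_pos_on (f := fun t => (g t).re) ?_ ?_ zero_lt_one
  · exact ⟨hgi.1.re, hgi.2.re⟩
  intro t ht
  have htz := ofReal_mul_mem_unitDisk ht.1.le ht.2.le hz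
  have hlip : ‖H (t * z) - H z‖ ≤ M * ‖t * z - z‖ :=
    (convex_ball (0 : ℂ) 1).norm_image_sub_le_of_norm_hasDerivWithin_le
      (fun x hx => (hH x hx).hasDerivWithinAt) hbound hz htz
  have hM0 : 0 < M := (norm_nonneg _).trans_lt (hv z hz)
  have hdist : ‖(t : ℂ) * z - z‖ ≤ 1 := by
    have : (t : ℂ) * z - z = ((t - 1 : ℝ) : ℂ) * z := by push_cast; ring
    rw [this, norm_mul, Complex.norm_real, Real.norm_eq_abs]
    have h1 : |t - 1| ≤ 1 := abs_le.2 ⟨by linarith [ht.1], by linarith [ht.2]⟩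
    exact mul_le_one₀ h1 (norm_nonneg _) hz1.le
  have him : |(H (t * z) - H z).im| ≤ 1 := by
    refine (Complex.abs_im_le_norm _).trans (hlip.trans ?_)
    exact mul_le_one₀ hM1 (norm_nonneg _) hdist
  have hgt : g t = ((t ^ c : ℝ) : ℂ) * Complex.exp (H (t * z) - H z) := by
    simp only [hg]
    rw [Complex.exp_sub, ← hexp z hz, ← hexp _ htz]
    push_cast
    ring
  change 0 < (g t).re
  rw [hgt, Complex.re_ofReal_mul, Complex.exp_re]
  refine mul_pos (pow_pos ht.1 c) (mul_pos (Real.exp_pos _) (Real.cos_pos_of_mem_Ioo ?_))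
  have hπ := Real.pi_gt_three
  rw [abs_le] at him
  exact ⟨by linarith [him.1], by linarith [him.2]⟩

/-! ### The Briot–Bouquet differential equation -/

/-- If `|u|` attained a value `≥ M` on the disk, then at a maximum point on the circle through it
Jack's lemma would make `v = u (1 + k / (b + u))` with `k ≥ 0`, hence `|v| ≥ |u| ≥ M`. -/
lemma norm_lt_of_briotBouquet {u v : ℂ → ℂ} {b : ℂ} {M : ℝ} (hu : DifferentiableOn ℂ u unitDisk)
    (hv : ∀ z ∈ unitDisk, ‖v z‖ < M) (h0 : u 0 = 0) (hb : ∀ z ∈ unitDisk, 0 < (b + u z).re)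
    (heq : ∀ z ∈ unitDisk, z * deriv u z + (b + u z) * u z = (b + u z) * v z) :
    ∀ z ∈ unitDisk, ‖u z‖ < M := by
  intro z hz
  have hM : 0 < M := (norm_nonneg _).trans_lt (hv z hz)
  rcases eq_or_ne z 0 with rfl | hz0
  · simpa [h0] using hM
  have hz1 : ‖z‖ < 1 := by simpa [unitDisk] using hz
  have hmem : ∀ w : ℂ, ‖w‖ ≤ ‖z‖ → w ∈ unitDisk := fun w hw => by
    simpa [unitDisk] using hw.trans_lt hz1
  obtain ⟨z₀, hz₀, hmax, k, hk, hkeq⟩ := exists_mul_deriv_mul_conj_nonneg (u := u)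
    (norm_pos_iff.2 hz0) fun w hw => hu.differentiableAt (isOpen_ball.mem_nhds (hmem w hw))
  refine (hmax z le_rfl).trans_lt ?_
  have hm := hmem z₀ hz₀.le
  rcases eq_or_ne (u z₀) 0 with hu0 | hu0
  · simpa [hu0] using hM
  have hbz := hb z₀ hm
  have hb0 : b + u z₀ ≠ 0 := fun h => by simp [h] at hbz
  set κ : ℝ := k / Complex.normSq (u z₀) with hκ
  have hκ0 : 0 ≤ κ := div_nonneg hk (Complex.normSq_nonneg _)
  have hvu : v z₀ = u z₀ * (1 + κ / (b + u z₀)) := by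
    have hc0 : conj (u z₀) ≠ 0 := (map_ne_zero _).2 hu0
    have h1 : (κ : ℂ) * u z₀ = z₀ * deriv u z₀ := by
      rw [hκ, Complex.ofReal_div, ← Complex.mul_conj, ← hkeq]
      field_simp
    have h2 := heq z₀ hm
    rw [← h1] at h2
    field_simp
    linear_combination -h2
  have hge : 1 ≤ ‖1 + κ / (b + u z₀)‖ := by
    refine le_trans ?_ (Complex.re_le_norm _)
    rw [Complex.add_re, Complex.one_re, le_add_iff_nonneg_right, div_eq_mul_inv,
      Complex.re_ofReal_mul, Complex.inv_re]
    exact mul_nonneg hκ0 (div_nonneg hbz.le (Complex.normSq_nonneg _))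
  calc ‖u z₀‖ ≤ ‖u z₀‖ * ‖1 + κ / (b + u z₀)‖ := le_mul_of_one_le_right (norm_nonneg _) hge
    _ = ‖v z₀‖ := by rw [hvu, norm_mul]
    _ < M := hv z₀ hm

/-- The inequality behind the value of `M`. With `P = 1 + u` the worst case is `P = 1 + M`,
`1 + v = 1 - M`, where the left side vanishes precisely because `M ^ 2 + 2 * c * M = 1`. -/
lemma re_briotBouquet_pos {c : ℕ} {M : ℝ} (hM0 : 0 < M) (hM : M ^ 2 + 2 * c * M = 1) {u v : ℂ}
    (hu : ‖u‖ < M) (hv : ‖v‖ < M) : 0 < ((1 + v) * (1 + c / (1 + u)) - c).re := by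
  have hM1 : M ≤ 1 := by
    have : 0 ≤ 2 * (c : ℝ) * M := by positivity
    nlinarith
  rcases Nat.eq_zero_or_pos c with rfl | hc
  · have := (abs_le.1 (Complex.abs_re_le_norm v)).1
    simp only [Nat.cast_zero, zero_div, add_zero, mul_one, sub_zero, Complex.add_re, Complex.one_re]
    linarith
  have hc1 : (1 : ℝ) ≤ c := by exact_mod_cast hc
  have hM2 : M < 1 / 2 := by nlinarith
  set P := 1 + u with hP
  have hP0 : P ≠ 0 := by
    intro h
    have : u = -1 := by linear_combination hP.symm.trans h
    rw [this, norm_neg, norm_one] at hu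
    linarith
  set w := P⁻¹ with hw
  have hw0 : w ≠ 0 := inv_ne_zero hP0
  have hdisc : ‖1 - w‖ ≤ M * ‖w‖ := by
    have : 1 - w = u * w := by
      rw [hw]
      field_simp
      rw [hP]
      ring
    rw [this, norm_mul]
    gcongr
  -- `w = 1 / P` lies in the disk with diameter `[1 / (1 + M), 1 / (1 - M)]`.
  have hsq : (1 - w.re) ^ 2 + w.im ^ 2 ≤ M ^ 2 * (w.re ^ 2 + w.im ^ 2) := by
    have h1 : ‖1 - w‖ ^ 2 ≤ (M * ‖w‖) ^ 2 := by gcongr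
    rw [mul_pow, ← Complex.normSq_eq_norm_sq, ← Complex.normSq_eq_norm_sq, Complex.normSq_apply,
      Complex.normSq_apply] at h1
    simp only [Complex.sub_re, Complex.one_re, Complex.sub_im, Complex.one_im] at h1
    nlinarith
  set x := w.re with hx
  set y := w.im with hy
  set e := (1 + M)⁻¹ with he
  have hee : e * (1 + M) = 1 := inv_mul_cancel₀ (by positivity)
  have hxe : e ≤ x := by
    rw [he, inv_le_iff_one_le_mul₀ (by positivity)]
    by_contra! hlt
    have h1 : 0 < 1 - (1 - M) * x := by
      rcases le_total 0 x with h | h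
      · nlinarith
      · nlinarith
    nlinarith [mul_pos (sub_pos.2 hlt) h1, sq_nonneg y, mul_nonneg (by nlinarith : 0 ≤ 1 - M ^ 2)
      (sq_nonneg y)]
  -- `M ^ 2 + 2 c M = 1` is `2 c M = (1 - M) (1 + M)`; multiply by `e / 2`.
  have hcMe : c * M * e = (1 - M) / 2 := by
    linear_combination (-(1 - M) / 2) * hee.symm + (e / 2) * hM
  have hXc : 1 + c * x - c = (1 + M) / 2 + c * (x - e) := by
    have h2 : c * e = c - c * M * e := by linear_combination (c : ℝ) * hee
    linear_combination h2 - hcMe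
  -- Eliminating `y` leaves a quadratic inequality in `x - e`, with equality at `x = e`.
  have hA : (M * ‖1 + c * w‖) ^ 2 ≤ (1 + c * x - c) ^ 2 := by
    rw [mul_pow, ← Complex.normSq_eq_norm_sq, Complex.normSq_apply]
    simp only [Complex.add_re, Complex.one_re, Complex.add_im, Complex.one_im, Complex.mul_re,
      Complex.mul_im, Complex.natCast_re, Complex.natCast_im, zero_mul, sub_zero, add_zero, zero_add]
    rw [← hx, ← hy]
    have h1 : 2 * c * M * (x ^ 2 + y ^ 2) ≤ 2 * x - 1 := by
      have : 2 * c * M = 1 - M ^ 2 := by linarith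
      rw [this]
      nlinarith
    have h2 := mul_le_mul_of_nonneg_left h1 (by positivity : 0 ≤ c * M / 2)
    have h3 : M ^ 2 * (1 + 2 * c * x) + c * M / 2 * (2 * x - 1)
        = (1 + M) ^ 2 / 4 + c * (x - e) * (M * (1 + 2 * M)) := by
      linear_combination (2 * M + 1) * hcMe - hM / 4
    have h4 : c * (x - e) * (M * (1 + 2 * M)) ≤ c * (x - e) * (1 + M) := by
      refine mul_le_mul_of_nonneg_left (by nlinarith) ?_
      exact mul_nonneg (by positivity) (sub_nonneg.2 hxe)
    rw [hXc]
    nlinarith [sq_nonneg ((c : ℝ) * (x - e))]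
  have hnn : 0 ≤ 1 + c * x - c := by
    rw [hXc]
    have : 0 ≤ c * (x - e) := mul_nonneg (by positivity) (sub_nonneg.2 hxe)
    positivity
  have hA' : M * ‖1 + c * w‖ ≤ 1 + c * x - c := le_of_sq_le_sq hA hnn
  have hre : (1 + c * w).re = 1 + c * x := by simp [hx]
  have hpos : 0 < ‖1 + c * w‖ := by
    refine lt_of_lt_of_le ?_ (Complex.re_le_norm _)
    rw [hre]
    linarith
  have hvA : -(‖v‖ * ‖1 + c * w‖) ≤ (v * (1 + c * w)).re := by
    rw [← norm_mul]
    exact (abs_le.1 (Complex.abs_re_le_norm _)).1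
  have hlt := mul_lt_mul_of_pos_right hv hpos
  have hsplit : ((1 + v) * (1 + c / P) - c).re = 1 + c * x - c + (v * (1 + c * w)).re := by
    have : (1 + v) * (1 + c / P) - c = (1 + c * w) - c + v * (1 + c * w) := by
      rw [div_eq_mul_inv]
      ring
    rw [this, Complex.add_re, Complex.sub_re, hre, Complex.natCast_re]
  rw [hsplit]
  linarith

/-! ### Convexity of the Bernardi transform -/

/-- The criterion for convexity applied to `F = z I`, where `I` is `transformQuot c h`. With
`u = z I' / I` and `v = z h' / h` the equation `z I' + (1 + c) I = (1 + c) h` gives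
`v = u + z u' / (1 + c + u)`, and then `1 + z F'' / F' = (1 + v) (1 + c / (1 + u)) - c`. -/
theorem injOn_and_convex_image_mul_transformQuot {c : ℕ} {h : ℂ → ℂ} {M : ℝ} (hM0 : 0 < M)
    (hM : M ^ 2 + 2 * c * M = 1) (hd : DifferentiableOn ℂ h unitDisk)
    (h0 : ∀ z ∈ unitDisk, h z ≠ 0) (hv : ∀ z ∈ unitDisk, ‖z * (deriv h z / h z)‖ < M) :
    InjOn (fun z => z * transformQuot c h z) unitDisk ∧
      Convex ℝ ((fun z => z * transformQuot c h z) '' unitDisk) := by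
  have ho : IsOpen unitDisk := isOpen_ball
  have hM1 : M ≤ 1 := by
    have : 0 ≤ 2 * (c : ℝ) * M := by positivity
    nlinarith
  set J := transformQuot c h with hJ
  have hJd : DifferentiableOn ℂ J unitDisk := differentiableOn_transformQuot c hd
  have hre : ∀ z ∈ unitDisk, 0 < (J z / h z).re := fun z hz =>
    re_transformQuot_div_pos c hM1 hd h0 hv hz
  have hJ0 : ∀ z ∈ unitDisk, J z ≠ 0 := fun z hz hJz => by simpa [hJz] using hre z hz
  set u : ℂ → ℂ := fun z => z * (deriv J z / J z) with hu
  have hud : DifferentiableOn ℂ u unitDisk :=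
    differentiableOn_id.mul ((hJd.deriv ho).div hJd hJ0)
  have huJ : ∀ z ∈ unitDisk, u z * J z = z * deriv J z := fun z hz => by
    have := hJ0 z hz
    simp only [hu]
    field_simp
  have hode : ∀ z ∈ unitDisk, (1 + c + u z) * J z = (1 + c) * h z := fun z hz => by
    linear_combination huJ z hz + mul_deriv_transformQuot_add c hd hz
  have hJat : ∀ z ∈ unitDisk, HasDerivAt J (deriv J z) z := fun z hz =>
    (hJd.differentiableAt (ho.mem_nhds hz)).hasDerivAt
  have huat : ∀ z ∈ unitDisk, HasDerivAt u (deriv u z) z := fun z hz =>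
    (hud.differentiableAt (ho.mem_nhds hz)).hasDerivAt
  have hbb : ∀ z ∈ unitDisk, z * deriv u z + (1 + c + u z) * u z
      = (1 + c + u z) * (z * (deriv h z / h z)) := by
    intro z hz
    have h1 := ((huat z hz).const_add (1 + (c : ℂ))).mul (hJat z hz)
    have h2 := ((hd.differentiableAt (ho.mem_nhds hz)).hasDerivAt.const_mul (1 + (c : ℂ)))
    have h3 := h1.unique (h2.congr_of_eventuallyEq
      (Filter.eventuallyEq_of_mem (ho.mem_nhds hz) hode))
    have h4 : h z * (deriv h z / h z) = deriv h z := mul_div_cancel₀ _ (h0 z hz)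
    -- Differentiate the equation `(1 + c + u) J = (1 + c) h`, multiply by `z` and cancel `J`.
    refine mul_right_cancel₀ (hJ0 z hz) ?_
    linear_combination z * h3 + (1 + c + u z) * huJ z hz - z * (deriv h z / h z) * hode z hz
      - z * (1 + c) * h4
  have hbpos : ∀ z ∈ unitDisk, 0 < (1 + c + u z).re := by
    intro z hz
    have hne : J z / h z ≠ 0 := div_ne_zero (hJ0 z hz) (h0 z hz)
    have h1 : 1 + c + u z = ((1 + c : ℝ) : ℂ) * (J z / h z)⁻¹ := by
      have := hJ0 z hz
      rw [inv_div]
      field_simp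
      push_cast
      exact hode z hz
    rw [h1, Complex.re_ofReal_mul, Complex.inv_re]
    exact mul_pos (by positivity) (div_pos (hre z hz) (Complex.normSq_pos.2 hne))
  have hun := norm_lt_of_briotBouquet hud hv (by simp [hu]) hbpos hbb
  have hP0 : ∀ z ∈ unitDisk, 1 + u z ≠ 0 := by
    intro z hz hz0
    have h1 := hun z hz
    have h2 : u z = -1 := by linear_combination hz0
    rw [h2, norm_neg, norm_one] at h1
    linarith
  refine injOn_and_convex_image_of_re_pos (G := fun z => J z * (1 + u z)) ?_ ?_ ?_ ?_
  · intro z hz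
    convert! (hasDerivAt_id' z).mul (hJat z hz) using 1
    linear_combination huJ z hz
  · exact hJd.mul (hud.const_add 1)
  · exact fun z hz => mul_ne_zero (hJ0 z hz) (hP0 z hz)
  · intro z hz
    have hder : deriv (fun z => J z * (1 + u z)) z = deriv J z * (1 + u z) + J z * deriv u z :=
      ((hJat z hz).mul ((huat z hz).const_add 1)).deriv
    have hQ := re_briotBouquet_pos hM0 hM (hun z hz) (hv z hz)
    convert! hQ using 2
    have hJz := hJ0 z hz
    have hPz := hP0 z hz
    rw [hder]
    have h1 : ∀ D U V j : ℂ, j ≠ 0 → 1 + V ≠ 0 → V * j = z * D →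
        z * ((D * (1 + V) + j * U) / (j * (1 + V))) = V + z * U / (1 + V) := by
      intro D U V j hj hV hVj
      field_simp
      linear_combination (-(1 + V)) * hVj
    rw [h1 _ _ _ _ hJz hPz (huJ z hz)]
    have h2 := hbb z hz
    generalize z * (deriv h z / h z) = V at h2 ⊢
    field_simp
    linear_combination h2

/-- The Bernardi transform maps `S_M` into `K` for the positive root `M` of `M ^ 2 + 2 c M = 1`. -/
theorem transform_mem_classK {c : ℕ} {M : ℝ} (hM0 : 0 < M) (hM : M ^ 2 + 2 * c * M = 1)
    {f : ℂ → ℂ} (hf : f ∈ classSM M) : transform c f ∈ classK := by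
  obtain ⟨⟨hfd, hf0, hf1⟩, hfM⟩ := hf
  have ho : IsOpen unitDisk := isOpen_ball
  have hmem : (0 : ℂ) ∈ unitDisk := by simp [unitDisk]
  set h := dslope f 0 with hh
  have hd : DifferentiableOn ℂ h unitDisk :=
    (Complex.differentiableOn_dslope (ho.mem_nhds hmem)).2 hfd
  have hfh : ∀ z, f z = z * h z := fun z => by
    simpa [hf0] using (sub_smul_dslope f 0 z).symm
  have hh0 : h 0 = 1 := by rw [hh, dslope_same, hf1]
  have h0 : ∀ z ∈ unitDisk, h z ≠ 0 := by
    intro z hz hz0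
    rcases eq_or_ne z 0 with rfl | hne
    · simp [hh0] at hz0
    · exact (hfM z hz hne).1 (by rw [hfh, hz0, mul_zero])
  have hv : ∀ z ∈ unitDisk, ‖z * (deriv h z / h z)‖ < M := by
    intro z hz
    rcases eq_or_ne z 0 with rfl | hne
    · simpa using hM0
    · have hder : deriv f z = h z + z * deriv h z := by
        rw [funext hfh]
        exact deriv_id_mul (hd.differentiableAt (ho.mem_nhds hz))
      have h1 := (hfM z hz hne).2
      rw [hder, hfh z] at h1
      convert! h1 using 2
      have := h0 z hz
      field_simp
      ring
  have heq : EqOn (transform c f) (fun z => z * transformQuot c h z) unitDisk := fun z hz =>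
    transform_eq_mul (fun z _ => hfh z) hz
  have hJd := differentiableOn_transformQuot c hd
  obtain ⟨hinj, hconv⟩ := injOn_and_convex_image_mul_transformQuot hM0 hM hd h0 hv
  refine ⟨⟨⟨(differentiableOn_id.mul hJd).congr heq, ?_, ?_⟩, hinj.congr heq.symm⟩, ?_⟩
  · rw [heq hmem]
    simp
  · rw [(Filter.eventuallyEq_of_mem (ho.mem_nhds hmem) heq).deriv_eq,
      deriv_id_mul (hJd.differentiableAt (ho.mem_nhds hmem)), transformQuot_zero, hh0]
    simp
  · rwa [heq.image_eq]

end Bernardi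

theorem theorem1p1 (c : ℕ) :
    (∀ M : ℝ, 0 < M → M < Real.sqrt ((c : ℝ) ^ 2 + 1) - (c : ℝ) →
      ∀ f ∈ Bernardi.classSM M, Bernardi.transform c f ∈ Bernardi.classK) ∧
    Bernardi.transform c '' Bernardi.classSM (Real.sqrt ((c : ℝ) ^ 2 + 1) - (c : ℝ)) ⊆
      Bernardi.classK := by
  have hsq : Real.sqrt ((c : ℝ) ^ 2 + 1) ^ 2 = (c : ℝ) ^ 2 + 1 := Real.sq_sqrt (by positivity)
  have hpos : 0 < Real.sqrt ((c : ℝ) ^ 2 + 1) - (c : ℝ) :=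
    sub_pos.2 (Real.lt_sqrt_of_sq_lt (by linarith))
  have hM : (Real.sqrt ((c : ℝ) ^ 2 + 1) - c) ^ 2 + 2 * c * (Real.sqrt ((c : ℝ) ^ 2 + 1) - c) = 1 := by
    linear_combination hsq
  constructor
  · intro M _ hlt f hf
    exact Bernardi.transform_mem_classK hpos hM
      ⟨hf.1, fun z hz hz0 => ⟨(hf.2 z hz hz0).1, (hf.2 z hz hz0).2.trans hlt⟩⟩
  · rintro _ ⟨f, hf, rfl⟩
    exact Bernardi.transform_mem_classK hpos hM hf
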